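/- Let $\mathcal Y=\{\pm1\}$. There is a universal constant $C>0$ such that the following holds. Let $\mathcal X$ be a measurable space, $\mathcal H\subseteq\mathcal Y^{\mathcal X}$ a class of measurable predictors, $\mathcal T$ a (finite or infinite) collection of measurable maps $T:\mathcal X\to\mathcal X$, and $\mathcal D$ a probability distribution on $\mathcal X\times\mathcal Y$. Put $\mathcal H\circ\mathcal T=\{h\circ T:h\in\mathcal H,T\in\mathcal T\}$, $\mathrm{err}(h,T(\mathcal D))=\Pr_{(x,y)\sim\mathcal D}[h(T(x))\ne y]$ and $\mathsf{OPT}_\infty=\inf_{h\in\mathcal H}\sup_{T\in\mathcal T}\mathrm{err}(h,T(\mathcal D))$. Assume that $d=\mathrm{vc}(\mathcal H\circ\mathcal T)$ is finite, and that $\mathcal H\circ\mathcal T$ satisfies the usual measurability condition of VC theory: for all $m,k$, the event that some $f\in\mathcal H\circ\mathcal T$ is consistent with a sample $S\sim\mathcal D^m$ and makes at least $k$ errors on an independent second sample $S'\sim\mathcal D^m$ is measurable up to null sets (this is automatic if $\mathcal H\circ\mathcal T$ is countable). Assume that $\mathsf{OPT}_\infty=0$ and, if $\mathcal T$ is infinite,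 that there is $h^\star\in\mathcal H$ such that for $\mathcal D$-almost every $(x,y)$ one has $h^\star(T(x))=y$ for all $T\in\mathcal T$ (for countable $\mathcal T$ the latter says that some $h^\star\in\mathcal H$ has $\mathrm{err}(h^\star,T(\mathcal D))=0$ for all $T\in\mathcal T$). An ERM for $\mathcal H$ is a rule that, given a set $U$ of labelled points, outputs an element of $\mathcal H$ with the least number (in $\mathbb N\cup\{\infty\}$) of errors on $U$. Then for any ERM for $\mathcal H$, all $\varepsilon,\delta\in(0,1/2)$ and every integer $$m\ \ge\ C\,\frac{d\log(1/\varepsilon)+\log(1/\delta)}{\varepsilon},$$ with probability at least $1-\delta$ over $S\sim\mathcal D^{m}$, $$\forall T\in\mathcal T:\quad \mathrm{err}(\hat h,T(\mathcal D))\le\varepsilon,$$ where $\hat h$ is the output of the ERM on the inflated dataset $\mathcal T(S)=\{(T(x),y):(x,y)\in S,\ T\in\mathcal T\}$. -/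

import Mathlib

open MeasureTheory

universe u

namespace TransformShift

/-- The label space `{+1, -1}`, encoded as `Bool` (`true` is `+1`). -/
abbrev Label : Type := Bool

/-- The composed class `H ∘ 𝒯 = {h ∘ T : h ∈ H, T ∈ 𝒯}`. -/
def compClass {X : Type u} (H : Set (X → Label)) (𝒯 : Set (X → X)) : Set (X → Label) :=
  {f | ∃ h ∈ H, ∃ T ∈ 𝒯, f = h ∘ T}

/-- `F` shatters the finite set `s`: every labelling of `s` is realized by a member of `F`. -/
def Shatters {X : Type u} (F : Set (X → Label)) (s : Finset X) : Prop :=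
  ∀ g : X → Label, ∃ f ∈ F, ∀ x ∈ s, f x = g x

/-- The VC dimension: the supremum of the sizes of the shattered finite sets. -/
noncomputable def vcDim {X : Type u} (F : Set (X → Label)) : ℕ∞ :=
  ⨆ (s : Finset X) (_ : Shatters F s), (s.card : ℕ∞)

/-- `err(h, T(D)) = P_{(x,y) ∼ D}[h(T(x)) ≠ y]`. -/
noncomputable def err {X : Type u} [MeasurableSpace X] (D : Measure (X × Label))
    (h : X → Label) (T : X → X) : ℝ :=
  D.real {p | h (T p.1) ≠ p.2}

/-- `OPT_∞ = inf_{h ∈ H} sup_{T ∈ 𝒯} err(h, T(D))`. -/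
noncomputable def optInf {X : Type u} [MeasurableSpace X] (D : Measure (X × Label))
    (H : Set (X → Label)) (𝒯 : Set (X → X)) : ℝ :=
  ⨅ h : H, ⨆ T : 𝒯, err D h T

/-- The inflated dataset `𝒯(S) = {(T(x), y) : (x, y) ∈ S, T ∈ 𝒯}` of a sample `S`. -/
def inflate {X : Type u} (𝒯 : Set (X → X)) {m : ℕ} (S : Fin m → X × Label) :
    Set (X × Label) :=
  {q | ∃ i, ∃ T ∈ 𝒯, q = (T (S i).1, (S i).2)}

/-- `A` is an ERM for `H`: given a dataset `U`, it outputs a member of `H` with the least number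
of errors on `U`. The number is counted in `ℕ∞`, so that infinite datasets are allowed; whenever
some member of `H` is consistent with `U`, the output is consistent with `U`. -/
def IsERM {X : Type u} (H : Set (X → Label)) (A : Set (X × Label) → X → Label) : Prop :=
  ∀ U : Set (X × Label), A U ∈ H ∧
    ∀ h ∈ H, {p ∈ U | A U p.1 ≠ p.2}.encard ≤ {p ∈ U | h p.1 ≠ p.2}.encard

/-- The class `F` is well-behaved for `D`: the usual measurability condition of VC theory, namely
that for a sample `S.1` and an independent ghost sample `S.2` of the same size, the event that some
member of `F` is consistent with `S.1` and makes at least `k` errors on `S.2` is measurable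
(up to null sets). -/
def WellBehaved {X : Type u} [MeasurableSpace X] (D : Measure (X × Label))
    (F : Set (X → Label)) : Prop :=
  ∀ m k : ℕ, NullMeasurableSet
    {S : (Fin m → X × Label) × (Fin m → X × Label) |
      ∃ f ∈ F, (∀ i, f (S.1 i).1 = (S.1 i).2) ∧
        k ≤ (Finset.univ.filter fun i => f (S.2 i).1 ≠ (S.2 i).2).card}
    ((Measure.pi fun _ : Fin m => D).prod (Measure.pi fun _ : Fin m => D))

/-- Some `h ∈ H` labels, for `D`-almost every `(x, y)`, all transformed points `T(x)`, `T ∈ 𝒯`,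
correctly. For countable `𝒯` this says exactly that some `h ∈ H` has `err(h, T(D)) = 0` for all
`T ∈ 𝒯`. -/
def RealizableAE {X : Type u} [MeasurableSpace X] (D : Measure (X × Label))
    (H : Set (X → Label)) (𝒯 : Set (X → X)) : Prop :=
  ∃ h ∈ H, ∀ᵐ p ∂D, ∀ T ∈ 𝒯, h (T p.1) = p.2

end TransformShift

/-! Write `F` for `compClass H 𝒯`. Since `err D h T` is the `D`-error of `h ∘ T`, transformations
enter only through `F`. If some member of `H` fits the inflated sample, so does the ERM output `ĥ`;
then every `ĥ ∘ T` is a member of `F` consistent with the original sample `S`. It remains to bound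
the probability that some consistent `f ∈ F` has error above `ε`, which handles all `T` at once.

That bound (`measure_exists_consistent_le`) is the double-sample argument. A bad `f` makes at least
`k = ⌈εm/4⌉` errors on a ghost sample with probability at least 1/2. Random exchanges between the
samples preserve their law, and for each labelling of the at most `2m` points at most a fraction
`2^(-k)` of them leaves all errors on the ghost side. Sauer–Shelah in the form `|trace| ≤ (1+x)^(2m)
/ x^d` with `x = ε/32` counts the labellings; taking `x` proportional to `ε` yields `log (1/ε)`
directly, with no `log m` to absorb.

Consistency holds almost surely (`measure_not_consistent_eq_zero`): for infinite `𝒯` by the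
realizability hypothesis, for finite `𝒯` by a union bound with near-optimal `h`, as the infimum need
not be attained. -/

namespace TransformShift

/-! ### Traces and the Sauer–Shelah lemma -/

open scoped Classical in
/-- The trace of `F` on `V`, as the family of the positively labelled subsets of `V`. -/
noncomputable def trace {X : Type u} (F : Set (X → Label)) (V : Finset X) : Finset (Finset X) :=
  V.powerset.filter fun u => ∃ f ∈ F, u = V.filter fun x => f x = true

open scoped Classical in
/-- If the trace of `F` on `V` shatters `s`, then `s ⊆ V` and `F` shatters `s`. -/
lemma subset_and_shatters_of_trace {X : Type u} {F : Set (X → Label)} {V s : Finset X}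
    (hs : (trace F V).Shatters s) : s ⊆ V ∧ Shatters F s := by
  have hsV : s ⊆ V := by
    obtain ⟨u, hu, hsu⟩ := hs.exists_superset
    exact hsu.trans (Finset.mem_powerset.1 (Finset.mem_filter.1 hu).1)
  refine ⟨hsV, fun g => ?_⟩
  obtain ⟨u, hu, hsu⟩ := hs (Finset.filter_subset (fun x => g x = true) s)
  obtain ⟨f, hf, rfl⟩ := (Finset.mem_filter.1 hu).2
  refine ⟨f, hf, fun x hx => ?_⟩
  have h := Finset.ext_iff.1 hsu x
  simp only [Finset.mem_inter, Finset.mem_filter, hx, hsV hx, true_and] at h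
  exact Bool.eq_iff_iff.2 h

lemma Shatters.card_le {X : Type u} {F : Set (X → Label)} {d : ℕ} (hd : vcDim F = d)
    {s : Finset X} (hs : Shatters F s) : s.card ≤ d := by
  have : (s.card : ℕ∞) ≤ vcDim F :=
    le_iSup₂_of_le (f := fun (s : Finset X) (_ : Shatters F s) => (s.card : ℕ∞)) s hs le_rfl
  rw [hd] at this
  exact_mod_cast this

/-- A weighted form of the Sauer–Shelah lemma. -/
lemma card_trace_mul_pow_le {X : Type u} {F : Set (X → Label)} {d : ℕ} (hd : vcDim F = d)
    (V : Finset X) {x : ℝ} (hx0 : 0 ≤ x) (hx1 : x ≤ 1) :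
    ((trace F V).card : ℝ) * x ^ d ≤ (1 + x) ^ V.card := by
  classical
  have hsh : ∀ s ∈ (trace F V).shatterer, s ⊆ V ∧ Shatters F s := fun s hs =>
    subset_and_shatters_of_trace (by convert Finset.mem_shatterer.1 hs)
  have hsub : (trace F V).shatterer ⊆ V.powerset := fun s hs =>
    Finset.mem_powerset.2 (hsh s hs).1
  -- Pajor's inequality: a family has at most as many members as shattered sets. These have size at
  -- most `d`, so `x ^ d ≤ x ^ s.card` for `x ≤ 1`; the sum over all subsets is binomial.
  calc ((trace F V).card : ℝ) * x ^ d
      ≤ (trace F V).shatterer.card * x ^ d := by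
        refine mul_le_mul_of_nonneg_right (Nat.cast_le.2 ?_) (pow_nonneg hx0 d)
        convert Finset.card_le_card_shatterer (trace F V)
    _ = ∑ _s ∈ (trace F V).shatterer, x ^ d := by simp
    _ ≤ ∑ s ∈ (trace F V).shatterer, x ^ s.card := Finset.sum_le_sum fun s hs =>
        pow_le_pow_of_le_one hx0 hx1
          ((hsh s hs).2.card_le hd)
    _ ≤ ∑ s ∈ V.powerset, x ^ s.card :=
        Finset.sum_le_sum_of_subset_of_nonneg hsub fun _ _ _ => pow_nonneg hx0 _
    _ = (1 + x) ^ V.card := by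
        have := Finset.prod_one_add (f := fun _ : X => x) V
        simp only [Finset.prod_const] at this
        exact this.symm

/-! ### Counting exchanges of a double sample -/

/-- Exchange the `i`-th entries of the two samples for all `i` with `σ i = true`. -/
def swap {Z : Type*} {m : ℕ} (σ : Fin m → Bool) (S : (Fin m → Z) × (Fin m → Z)) :
    (Fin m → Z) × (Fin m → Z) :=
  (fun i => if σ i then S.2 i else S.1 i, fun i => if σ i then S.1 i else S.2 i)

/-- The pairs of samples for which some member of `F` is consistent with the first one and makes
at least `k` errors on the second one. -/
def ghostEvent {X : Type u} (F : Set (X → Label)) (m k : ℕ) :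
    Set ((Fin m → X × Label) × (Fin m → X × Label)) :=
  {S | ∃ f ∈ F, (∀ i, f (S.1 i).1 = (S.1 i).2) ∧
    k ≤ (Finset.univ.filter fun i => f (S.2 i).1 ≠ (S.2 i).2).card}

open scoped Classical in
/-- For a single predictor, at most a fraction `2 ^ (-k)` of the exchanges leads to no error on the
first sample and at least `k` errors on the second one. -/
lemma card_swap_mem_ghostEvent_singleton {X : Type u} (f : X → Label) (m k : ℕ)
    (S : (Fin m → X × Label) × (Fin m → X × Label)) :
    (Finset.univ.filter fun σ : Fin m → Bool => swap σ S ∈ ghostEvent {f} m k).card * 2 ^ k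
      ≤ 2 ^ m := by
  -- The product of these weights dominates `2 ^ k` times the indicator of the event, and its sum
  -- over `σ` factorizes. Each factor is at most 2: `1 + 1` if `f` is right on both entries, `2 + 0`
  -- if wrong on one, `0` if wrong on both.
  let w : Fin m → Bool → ℕ := fun i b =>
    if f ((swap (fun _ => b) S).1 i).1 = ((swap (fun _ => b) S).1 i).2 then
      if f ((swap (fun _ => b) S).2 i).1 ≠ ((swap (fun _ => b) S).2 i).2 then 2 else 1
    else 0
  have hw : ∀ i, ∑ b, w i b ≤ 2 := by
    intro i
    simp only [w, swap, Fintype.sum_bool]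
    by_cases h1 : f (S.1 i).1 = (S.1 i).2 <;> by_cases h2 : f (S.2 i).1 = (S.2 i).2 <;>
      simp [h1, h2]
  calc (Finset.univ.filter fun σ : Fin m → Bool => swap σ S ∈ ghostEvent {f} m k).card * 2 ^ k
      = ∑ σ : Fin m → Bool, if swap σ S ∈ ghostEvent {f} m k then 2 ^ k else 0 := by
        rw [← Finset.sum_filter, Finset.sum_const, smul_eq_mul]
    _ ≤ ∑ σ : Fin m → Bool, ∏ i, w i (σ i) := by
        refine Finset.sum_le_sum fun σ _ => ?_
        split_ifs with h
        · obtain ⟨g, rfl, hc, hk⟩ := h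
          have : ∀ i, w i (σ i) =
              if g ((swap σ S).2 i).1 ≠ ((swap σ S).2 i).2 then 2 else 1 := by
            intro i
            exact if_pos (hc i)
          simp only [this]
          rw [Finset.prod_ite, Finset.prod_const, Finset.prod_const_one, mul_one]
          exact Nat.pow_le_pow_right (by norm_num) (by convert hk)
        · exact Nat.zero_le _
    _ = ∏ i, ∑ b, w i b := by
        rw [Finset.prod_univ_sum, Fintype.piFinset_univ]
    _ ≤ ∏ _i : Fin m, 2 := Finset.prod_le_prod' fun i _ => hw i
    _ = 2 ^ m := by simp

open scoped Classical in
/-- The points occurring in two samples. -/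
noncomputable def points {X : Type u} {m : ℕ} (S : (Fin m → X × Label) × (Fin m → X × Label)) :
    Finset X :=
  Finset.univ.image (fun i => (S.1 i).1) ∪ Finset.univ.image (fun i => (S.2 i).1)

lemma card_points_le {X : Type u} {m : ℕ} (S : (Fin m → X × Label) × (Fin m → X × Label)) :
    (points S).card ≤ 2 * m := by
  classical
  have h1 := Finset.card_image_le (s := Finset.univ) (f := fun i => (S.1 i).1)
  have h2 := Finset.card_image_le (s := Finset.univ) (f := fun i => (S.2 i).1)
  have h3 := Finset.card_union_le (Finset.univ.image (fun i => (S.1 i).1))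
    (Finset.univ.image (fun i => (S.2 i).1))
  simp only [Finset.card_univ, Fintype.card_fin] at h1 h2
  unfold points
  omega

-- Exchanges do not change the set of occurring points, so membership in the event depends on `f`
-- only through its trace there. A union bound over one representative per trace reduces to a single
-- predictor.
open scoped Classical in
lemma card_swap_mem_ghostEvent {X : Type u} (F : Set (X → Label)) (m k : ℕ)
    (S : (Fin m → X × Label) × (Fin m → X × Label)) :
    (Finset.univ.filter fun σ : Fin m → Bool => swap σ S ∈ ghostEvent F m k).card * 2 ^ k
      ≤ (trace F (points S)).card * 2 ^ m := by
  have hsub : (Finset.univ.filter fun σ : Fin m → Bool => swap σ S ∈ ghostEvent F m k) ⊆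
      (trace F (points S)).biUnion fun u => Finset.univ.filter fun σ : Fin m → Bool =>
        swap σ S ∈ ghostEvent {fun x => decide (x ∈ u)} m k := by
    intro σ hσ
    obtain ⟨f, hf, hc, hk⟩ := (Finset.mem_filter.1 hσ).2
    have hp1 : ∀ i, (S.1 i).1 ∈ points S := fun i =>
      Finset.mem_union_left _ (Finset.mem_image_of_mem _ (Finset.mem_univ i))
    have hp2 : ∀ i, (S.2 i).1 ∈ points S := fun i =>
      Finset.mem_union_right _ (Finset.mem_image_of_mem _ (Finset.mem_univ i))
    have hf' : ∀ x ∈ points S,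
        decide (x ∈ (points S).filter fun x => f x = true) = f x := by
      intro x hx
      simp [hx]
    have hs1 : ∀ i, ((swap σ S).1 i).1 ∈ points S := by
      intro i
      by_cases h : σ i <;> simp [swap, h, hp1, hp2]
    have hs2 : ∀ i, ((swap σ S).2 i).1 ∈ points S := by
      intro i
      by_cases h : σ i <;> simp [swap, h, hp1, hp2]
    refine Finset.mem_biUnion.2 ⟨(points S).filter fun x => f x = true,
      Finset.mem_filter.2 ⟨Finset.mem_powerset.2 (Finset.filter_subset _ _), f, hf, rfl⟩,
      Finset.mem_filter.2 ⟨Finset.mem_univ _, _, rfl, fun i => ?_, ?_⟩⟩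
    · rw [hf' _ (hs1 i)]
      exact hc i
    · refine hk.trans (Finset.card_le_card fun i hi => ?_)
      simp only [Finset.mem_filter, Finset.mem_univ, true_and] at hi ⊢
      have := hf' _ (hs2 i)
      simp only [Finset.mem_filter] at this
      rw [this]
      exact hi
  calc _ ≤ (∑ u ∈ trace F (points S), (Finset.univ.filter fun σ : Fin m → Bool =>
        swap σ S ∈ ghostEvent {fun x => decide (x ∈ u)} m k).card) * 2 ^ k :=
        Nat.mul_le_mul_right _ ((Finset.card_le_card hsub).trans Finset.card_biUnion_le)
    _ = ∑ u ∈ trace F (points S), (Finset.univ.filter fun σ : Fin m → Bool =>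
        swap σ S ∈ ghostEvent {fun x => decide (x ∈ u)} m k).card * 2 ^ k := Finset.sum_mul _ _ _
    _ ≤ ∑ _u ∈ trace F (points S), 2 ^ m :=
        Finset.sum_le_sum fun u _ => card_swap_mem_ghostEvent_singleton _ m k S
    _ = _ := by simp

open scoped Classical in
lemma card_swap_mem_ghostEvent_le {X : Type u} {F : Set (X → Label)} {d : ℕ}
    (hd : vcDim F = d) (m k : ℕ) {x : ℝ} (hx0 : 0 < x) (hx1 : x ≤ 1)
    (S : (Fin m → X × Label) × (Fin m → X × Label)) :
    ((Finset.univ.filter fun σ : Fin m → Bool => swap σ S ∈ ghostEvent F m k).card : ℝ)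
      ≤ 2 ^ m * ((1 + x) ^ (2 * m) / (x ^ d * 2 ^ k)) := by
  have h1 : ((Finset.univ.filter fun σ : Fin m → Bool =>
      swap σ S ∈ ghostEvent F m k).card : ℝ) * 2 ^ k ≤ (trace F (points S)).card * 2 ^ m := by
    exact_mod_cast card_swap_mem_ghostEvent F m k S
  have h2 := card_trace_mul_pow_le hd (points S) hx0.le hx1
  have h3 : (1 + x) ^ (points S).card ≤ (1 + x) ^ (2 * m) :=
    pow_le_pow_right₀ (by linarith) (card_points_le S)
  rw [← mul_div_assoc, le_div_iff₀ (by positivity)]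
  calc _ = ((Finset.univ.filter fun σ : Fin m → Bool =>
      swap σ S ∈ ghostEvent F m k).card : ℝ) * 2 ^ k * x ^ d := by ring
    _ ≤ (trace F (points S)).card * 2 ^ m * x ^ d := by gcongr
    _ = 2 ^ m * ((trace F (points S)).card * x ^ d) := by ring
    _ ≤ _ := by
      gcongr
      exact h2.trans h3

end TransformShift

/-! ### Symmetrization and the deviation bound -/

namespace TransformShift

/-- Regarded as a sample of `m` independent pairs, the double sample is changed coordinatewise, each
pair being flipped or kept; both maps preserve `D.prod D`. -/
lemma measurePreserving_swap {Z : Type*} [MeasurableSpace Z] (D : Measure Z)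
    [IsProbabilityMeasure D] {m : ℕ} (σ : Fin m → Bool) :
    MeasurePreserving (swap σ)
      ((Measure.pi fun _ : Fin m => D).prod (Measure.pi fun _ : Fin m => D))
      ((Measure.pi fun _ : Fin m => D).prod (Measure.pi fun _ : Fin m => D)) := by
  have he := measurePreserving_arrowProdEquivProdArrow Z Z (Fin m) (fun _ => D) (fun _ => D)
  let g : Fin m → Z × Z → Z × Z := fun i => if σ i then Prod.swap else id
  have hg : ∀ i, MeasurePreserving (g i) (D.prod D) (D.prod D) := by
    intro i
    by_cases h : σ i
    · simpa only [g, h, if_true] using Measure.measurePreserving_swap (μ := D) (ν := D)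
    · simpa [g, h] using MeasurePreserving.id (D.prod D)
  have hpi := measurePreserving_pi (fun _ : Fin m => D.prod D) (fun _ => D.prod D) hg
  convert! (he.comp hpi).comp he.symm using 1
  funext S
  refine Prod.ext (funext fun i => ?_) (funext fun i => ?_) <;>
    by_cases h : σ i <;>
    simp [swap, g, h, MeasurableEquiv.arrowProdEquivProdArrow, Equiv.arrowProdEquivProdArrow]

/-- Symmetrization: if at most a fraction `c` of the exchanges of any pair of samples leads into
`E`, then `E` has probability at most `c`. -/
lemma measure_le_of_card_swap_le {Z : Type*} [MeasurableSpace Z] (D : Measure Z)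
    [IsProbabilityMeasure D] {m : ℕ} {E : Set ((Fin m → Z) × (Fin m → Z))}
    (hE : NullMeasurableSet E
      ((Measure.pi fun _ : Fin m => D).prod (Measure.pi fun _ : Fin m => D)))
    [DecidablePred (· ∈ E)] {c : ℝ}
    (hc : ∀ S, ((Finset.univ.filter fun σ : Fin m → Bool => swap σ S ∈ E).card : ℝ)
      ≤ 2 ^ m * c) :
    ((Measure.pi fun _ : Fin m => D).prod (Measure.pi fun _ : Fin m => D)) E
      ≤ ENNReal.ofReal c := by
  set μ := (Measure.pi fun _ : Fin m => D).prod (Measure.pi fun _ : Fin m => D)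
  have hσ : ∀ σ : Fin m → Bool, NullMeasurableSet (swap σ ⁻¹' E) μ := fun σ =>
    hE.preimage (measurePreserving_swap D σ).quasiMeasurePreserving
  have hsum : ∀ S, ∑ σ : Fin m → Bool, (swap σ ⁻¹' E).indicator (fun _ => (1 : ENNReal)) S
      ≤ ENNReal.ofReal (2 ^ m * c) := by
    intro S
    calc ∑ σ : Fin m → Bool, (swap σ ⁻¹' E).indicator (fun _ => (1 : ENNReal)) S
        = ((Finset.univ.filter fun σ : Fin m → Bool => swap σ S ∈ E).card : ENNReal) := by
          rw [Finset.card_filter, Nat.cast_sum]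
          refine Finset.sum_congr rfl fun σ _ => ?_
          by_cases h : swap σ S ∈ E <;> simp [h]
      _ = ENNReal.ofReal ((Finset.univ.filter fun σ : Fin m → Bool => swap σ S ∈ E).card : ℝ) :=
          (ENNReal.ofReal_natCast _).symm
      _ ≤ _ := ENNReal.ofReal_le_ofReal (hc S)
  have h : (2 : ENNReal) ^ m * μ E ≤ 2 ^ m * ENNReal.ofReal c := by
    calc (2 : ENNReal) ^ m * μ E = ∑ σ : Fin m → Bool, μ (swap σ ⁻¹' E) := by
          rw [Finset.sum_congr rfl fun σ _ =>
            (measurePreserving_swap D σ).measure_preimage hE]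
          simp [μ]
      _ = ∑ σ : Fin m → Bool, ∫⁻ S, (swap σ ⁻¹' E).indicator (fun _ => (1 : ENNReal)) S ∂μ := by
          refine Finset.sum_congr rfl fun σ _ => ?_
          rw [lintegral_indicator_const₀ (hσ σ), one_mul]
      _ = ∫⁻ S, ∑ σ : Fin m → Bool, (swap σ ⁻¹' E).indicator (fun _ => (1 : ENNReal)) S ∂μ :=
          (lintegral_finsetSum' _ fun σ _ => aemeasurable_const.indicator₀ (hσ σ)).symm
      _ ≤ ∫⁻ _, ENNReal.ofReal (2 ^ m * c) ∂μ := lintegral_mono hsum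
      _ = 2 ^ m * ENNReal.ofReal c := by
          rw [lintegral_const, measure_univ, mul_one, ENNReal.ofReal_mul (by positivity),
            ENNReal.ofReal_pow (by norm_num)]
          norm_num
  exact (ENNReal.mul_le_mul_iff_right (by positivity) (by finiteness)).1 h

open scoped Classical in
/-- A lower tail bound: a set of measure more than `ε` is hit at least `ε m / 4` times by an
i.i.d. sample of size `m` with probability at least `1 / 2`, if `ε m ≥ 4`. -/
lemma half_le_measure_hits {Z : Type*} [MeasurableSpace Z] (D : Measure Z)
    [IsProbabilityMeasure D] {B : Set Z} (hB : MeasurableSet B) {ε : ℝ}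
    (hεB : ε ≤ D.real B) {m : ℕ} (hm : 4 ≤ ε * m) :
    (1 / 2 : ENNReal) ≤ (Measure.pi fun _ : Fin m => D)
      {S | ⌈ε * m / 4⌉₊ ≤ (Finset.univ.filter fun i => S i ∈ B).card} := by
  set μ := Measure.pi fun _ : Fin m => D
  set N : (Fin m → Z) → ℕ := fun S => (Finset.univ.filter fun i => S i ∈ B).card
  -- Chernoff's method: the product of the `g (S i)` is `2 ^ (-N S)`, and Markov's inequality is
  -- applied at the level `t = 2 ^ (-εm/4)`.
  let g : Z → ℝ := fun z => 1 - B.indicator (fun _ => (1 / 2 : ℝ)) z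
  have hgm : Measurable g := measurable_const.sub (measurable_const.indicator hB)
  have hgN : ∀ S : Fin m → Z, ∏ i, g (S i) = (1 / 2 : ℝ) ^ N S := by
    intro S
    have : ∀ i, g (S i) = if S i ∈ B then (1 / 2 : ℝ) else 1 := by
      intro i
      by_cases h : S i ∈ B <;> simp [g, h]
      norm_num
    simp only [this, N]
    rw [Finset.prod_ite, Finset.prod_const, Finset.prod_const_one, mul_one]
  have hgi : ∫ z, g z ∂D = 1 - D.real B / 2 := by
    rw [integral_sub (integrable_const _) ((integrable_const _).indicator hB),
      integral_indicator_const _ hB]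
    simp
    ring
  have hprod : ∫ S, ∏ i, g (S i) ∂μ = (1 - D.real B / 2) ^ m := by
    rw [integral_fintype_prod_eq_pow, hgi, Fintype.card_fin]
  have hint : Integrable (fun S : Fin m → Z => ∏ i, g (S i)) μ := by
    refine Integrable.of_bound (C := 1)
      (Finset.measurable_prod _ fun i _ => hgm.comp (measurable_pi_apply i)).aestronglyMeasurable
      (Filter.Eventually.of_forall fun S => ?_)
    rw [hgN, Real.norm_of_nonneg (by positivity)]
    exact pow_le_one₀ (by norm_num) (by norm_num)
  have hlog : Real.log 2 < 0.7 := Real.log_two_lt_d9.trans (by norm_num)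
  set t := Real.exp (-(Real.log 2 * (ε * m / 4)))
  have hmarkov := mul_meas_ge_le_integral_of_nonneg
    (Filter.Eventually.of_forall fun S => by
      simp only [Pi.zero_apply]; rw [hgN]; positivity) hint t
  rw [hprod] at hmarkov
  have hsub : {S | ⌈ε * m / 4⌉₊ ≤ N S}ᶜ ⊆ {S | t ≤ ∏ i, g (S i)} := by
    intro S hS
    have hS' : (N S : ℝ) < ε * m / 4 := Nat.lt_ceil.1 (not_le.1 hS)
    simp only [Set.mem_ofPred_eq, hgN]
    have : (1 / 2 : ℝ) ^ N S = Real.exp (-(Real.log 2 * N S)) := by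
      rw [Real.exp_neg, Real.exp_mul, Real.exp_log (by norm_num), Real.rpow_natCast, one_div,
        inv_pow]
    rw [this]
    refine Real.exp_le_exp.2 (neg_le_neg ?_)
    exact mul_le_mul_of_nonneg_left hS'.le (Real.log_nonneg (by norm_num))
  have hpow : (1 - D.real B / 2) ^ m ≤ t * (1 / 2) := by
    have hB1 : D.real B ≤ 1 := measureReal_le_one
    have hmpos : (0 : ℝ) ≤ m := Nat.cast_nonneg m
    calc (1 - D.real B / 2) ^ m ≤ Real.exp (-(ε / 2)) ^ m := by
          refine pow_le_pow_left₀ (by linarith) ?_ m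
          have := Real.add_one_le_exp (-(ε / 2))
          linarith
      _ = Real.exp (-(ε * m / 2)) := by rw [← Real.exp_nat_mul]; ring_nf
      _ ≤ Real.exp (-(Real.log 2 * (ε * m / 4)) + -Real.log 2) := by
          refine Real.exp_le_exp.2 ?_
          -- With `log 2 < 0.7` and `εm ≥ 4`, `log 2 * (εm/4 + 1) ≤ 0.35 εm`.
          nlinarith
      _ = t * (1 / 2) := by
          rw [Real.exp_add, Real.exp_neg (Real.log 2), Real.exp_log (by norm_num), one_div]
  have hcompl : μ.real {S | ⌈ε * m / 4⌉₊ ≤ N S}ᶜ ≤ 1 / 2 :=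
    (measureReal_mono hsub).trans
      (le_of_mul_le_mul_left (hmarkov.trans hpow) (Real.exp_pos _))
  have hmeas : MeasurableSet {S | ⌈ε * m / 4⌉₊ ≤ N S} := by
    have hN : Measurable N := by
      have : N = fun S => ∑ i, if S i ∈ B then 1 else 0 := by
        funext S
        exact Finset.card_filter _ _
      rw [this]
      exact Finset.measurable_sum _ fun i _ =>
        Measurable.ite (measurable_pi_apply i hB) measurable_const measurable_const
    exact hN measurableSet_Ici
  rw [probReal_compl_eq_one_sub hmeas] at hcompl
  have : ENNReal.ofReal (1 / 2) ≤ ENNReal.ofReal (μ.real {S | ⌈ε * m / 4⌉₊ ≤ N S}) :=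
    ENNReal.ofReal_le_ofReal (by linarith)
  rw [ofReal_measureReal] at this
  simpa [ENNReal.ofReal_inv_of_pos] using this

/-- If the sections of `E` over `B` have probability at least `1 / 2`, then the outer measure of
`B` is at most twice that of `E`. -/
lemma measure_le_two_mul_prod {Y Z : Type*} [MeasurableSpace Y] [MeasurableSpace Z]
    (μ : Measure Y) (ν : Measure Z) [SFinite ν] {B : Set Y} {E : Set (Y × Z)}
    (h : ∀ y ∈ B, (1 / 2 : ENNReal) ≤ ν (Prod.mk y ⁻¹' E)) :
    μ B ≤ 2 * (μ.prod ν) E := by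
  -- The measurable hull has the same measure as `E` and larger sections, so neither `E` nor `B`
  -- need be measurable.
  have hE := measurableSet_toMeasurable (μ.prod ν) E
  have h1 : (1 / 2 : ENNReal) * μ B ≤ (μ.prod ν) E := by
    calc (1 / 2 : ENNReal) * μ B
        ≤ (1 / 2 : ENNReal) * μ {y | (1 / 2 : ENNReal) ≤
            ν (Prod.mk y ⁻¹' toMeasurable (μ.prod ν) E)} := by
          gcongr
          intro y hy
          exact (h y hy).trans
            (measure_mono (Set.preimage_mono (subset_toMeasurable (μ.prod ν) E)))
      _ ≤ ∫⁻ y, ν (Prod.mk y ⁻¹' toMeasurable (μ.prod ν) E) ∂μ :=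
          mul_meas_ge_le_lintegral (measurable_measure_prodMk_left hE) _
      _ = (μ.prod ν) E := by rw [← Measure.prod_apply hE, measure_toMeasurable]
  calc μ B = 2 * (1 / 2 * μ B) := by
        rw [← mul_assoc, one_div, ENNReal.mul_inv_cancel (by norm_num) (by norm_num), one_mul]
    _ ≤ _ := by gcongr

/-- The deviation bound of VC theory in the consistent case. -/
lemma measure_exists_consistent_le {X : Type u} [MeasurableSpace X] (D : Measure (X × Label))
    [IsProbabilityMeasure D] {F : Set (X → Label)} (hF : ∀ f ∈ F, Measurable f)
    (hW : WellBehaved D F) {d : ℕ} (hd : vcDim F = d) {ε : ℝ} {m : ℕ}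
    (hm : 4 ≤ ε * m) {x : ℝ} (hx0 : 0 < x) (hx1 : x ≤ 1) :
    (Measure.pi fun _ : Fin m => D) {S | ∃ f ∈ F, (∀ i, f (S i).1 = (S i).2) ∧
        ε < D.real {p | f p.1 ≠ p.2}}
      ≤ ENNReal.ofReal (2 * ((1 + x) ^ (2 * m) / (x ^ d * 2 ^ ⌈ε * m / 4⌉₊))) := by
  classical
  have hE : NullMeasurableSet (ghostEvent F m ⌈ε * m / 4⌉₊)
      ((Measure.pi fun _ : Fin m => D).prod (Measure.pi fun _ : Fin m => D)) := hW m _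
  have h1 : ((Measure.pi fun _ : Fin m => D).prod (Measure.pi fun _ : Fin m => D))
      (ghostEvent F m ⌈ε * m / 4⌉₊)
        ≤ ENNReal.ofReal ((1 + x) ^ (2 * m) / (x ^ d * 2 ^ ⌈ε * m / 4⌉₊)) :=
    measure_le_of_card_swap_le D hE fun S => by
      convert card_swap_mem_ghostEvent_le hd m _ hx0 hx1 S
  refine (measure_le_two_mul_prod (Measure.pi fun _ : Fin m => D)
    (Measure.pi fun _ : Fin m => D) (E := ghostEvent F m ⌈ε * m / 4⌉₊) ?_).trans ?_
  · rintro S ⟨f, hf, hc, herr⟩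
    have hB : MeasurableSet {p : X × Label | f p.1 ≠ p.2} :=
      (measurableSet_eq_fun ((hF f hf).comp measurable_fst) measurable_snd).compl
    refine (half_le_measure_hits D hB herr.le hm).trans (measure_mono fun S' hS' => ?_)
    refine ⟨f, hf, hc, ?_⟩
    rw [Set.mem_ofPred_eq] at hS'
    convert hS' using 2
    ext i
    simp
  · rw [ENNReal.ofReal_mul (by norm_num), ENNReal.ofReal_ofNat]
    gcongr

end TransformShift

/-! ### Realizability, ERM and the sample size -/

namespace TransformShift

lemma measure_pi_exists_not_le {Z : Type*} [MeasurableSpace Z] (D : Measure Z)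
    [IsProbabilityMeasure D] (m : ℕ) (P : Z → Prop) :
    (Measure.pi fun _ : Fin m => D) {S | ∃ i, P (S i)} ≤ m * D {z | P z} := by
  calc (Measure.pi fun _ : Fin m => D) {S | ∃ i, P (S i)}
      = (Measure.pi fun _ : Fin m => D) (⋃ i, Function.eval i ⁻¹' {z | P z}) := by
        congr 1
        ext S
        simp
    _ ≤ ∑ i : Fin m, (Measure.pi fun _ : Fin m => D) (Function.eval i ⁻¹' {z | P z}) :=
        measure_iUnion_fintype_le _ _
    _ ≤ ∑ _i : Fin m, D {z | P z} := Finset.sum_le_sum fun i _ =>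
        (measurePreserving_eval (fun _ : Fin m => D) i).measure_preimage_le _
    _ = m * D {z | P z} := by simp

lemma exists_forall_err_lt {X : Type u} [MeasurableSpace X] {D : Measure (X × Label)}
    [IsProbabilityMeasure D] {H : Set (X → Label)} {𝒯 : Set (X → X)} (hH : H.Nonempty)
    (hopt : optInf D H 𝒯 = 0) {η : ℝ} (hη : 0 < η) :
    ∃ h ∈ H, ∀ T ∈ 𝒯, err D h T < η := by
  have : Nonempty H := hH.to_subtype
  obtain ⟨h, hh⟩ := exists_lt_of_ciInf_lt (show (⨅ h : H, ⨆ T : 𝒯, err D h T) < η from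
    hopt.trans_lt hη)
  refine ⟨h, h.2, fun T hT => lt_of_le_of_lt ?_ hh⟩
  -- The bound 1 is needed: an unbounded real supremum would take the default value 0.
  exact le_ciSup (f := fun T : 𝒯 => err D h T)
    ⟨1, by rintro _ ⟨T, rfl⟩; exact measureReal_le_one⟩ ⟨T, hT⟩

/-- Under realizability, the inflated sample is almost surely consistent with some predictor. -/
lemma measure_not_consistent_eq_zero {X : Type u} [MeasurableSpace X] {D : Measure (X × Label)}
    [IsProbabilityMeasure D] {H : Set (X → Label)} {𝒯 : Set (X → X)} (hH : H.Nonempty)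
    (hopt : optInf D H 𝒯 = 0) (hinf : 𝒯.Infinite → RealizableAE D H 𝒯) (m : ℕ) :
    (Measure.pi fun _ : Fin m => D)
      {S | ¬ ∃ h ∈ H, ∀ i, ∀ T ∈ 𝒯, h (T (S i).1) = (S i).2} = 0 := by
  have key : ∀ h ∈ H, (Measure.pi fun _ : Fin m => D)
      {S | ¬ ∃ h ∈ H, ∀ i, ∀ T ∈ 𝒯, h (T (S i).1) = (S i).2}
        ≤ m * D {p | ¬ ∀ T ∈ 𝒯, h (T p.1) = p.2} := by
    intro h hh
    refine (measure_mono fun S hS => ?_).trans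
      (measure_pi_exists_not_le D m fun p => ¬ ∀ T ∈ 𝒯, h (T p.1) = p.2)
    by_contra hcon
    exact hS ⟨h, hh, fun i => not_not.1 fun hi => hcon ⟨i, hi⟩⟩
  by_cases hfin : 𝒯.Finite
  · refine le_antisymm (ENNReal.le_of_forall_pos_le_add fun η hη _ => ?_) zero_le
    -- The union bound runs over `m * |𝒯|` pairs; the `+ 1` keeps the denominator positive when
    -- there are none.
    have hc : (0 : ℝ) < m * hfin.toFinset.card + 1 := by positivity
    obtain ⟨h, hh, herr⟩ := exists_forall_err_lt hH hopt
      (div_pos (NNReal.coe_pos.2 hη) hc)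
    have hD : D {p | ¬ ∀ T ∈ 𝒯, h (T p.1) = p.2}
        ≤ hfin.toFinset.card * ENNReal.ofReal (η / (m * hfin.toFinset.card + 1)) := by
      calc D {p | ¬ ∀ T ∈ 𝒯, h (T p.1) = p.2}
          ≤ D (⋃ T ∈ hfin.toFinset, {p | h (T p.1) ≠ p.2}) := by
            refine measure_mono fun p hp => ?_
            simpa using hp
        _ ≤ ∑ T ∈ hfin.toFinset, D {p | h (T p.1) ≠ p.2} := measure_biUnion_finset_le _ _
        _ ≤ ∑ _T ∈ hfin.toFinset, ENNReal.ofReal (η / (m * hfin.toFinset.card + 1)) := by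
            refine Finset.sum_le_sum fun T hT => ?_
            rw [← ofReal_measureReal]
            exact ENNReal.ofReal_le_ofReal (herr T (hfin.mem_toFinset.1 hT)).le
        _ = _ := by simp
    rw [zero_add]
    calc _ ≤ m * (hfin.toFinset.card * ENNReal.ofReal (η / (m * hfin.toFinset.card + 1))) := by
          refine (key h hh).trans ?_
          gcongr
      _ = ENNReal.ofReal (m * hfin.toFinset.card * (η / (m * hfin.toFinset.card + 1))) := by
          rw [ENNReal.ofReal_mul (by positivity), ENNReal.ofReal_mul (by positivity),
            ENNReal.ofReal_natCast, ENNReal.ofReal_natCast, mul_assoc]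
      _ ≤ ENNReal.ofReal η := by
          refine ENNReal.ofReal_le_ofReal ?_
          rw [← mul_div_assoc, div_le_iff₀ hc]
          nlinarith [NNReal.coe_pos.2 hη]
      _ = η := ENNReal.ofReal_coe_nnreal
  · obtain ⟨h, hh, hae⟩ := hinf hfin
    have := key h hh
    rw [ae_iff.1 hae, mul_zero] at this
    exact le_antisymm this zero_le

/-- An ERM is consistent with every dataset with which some member of the class is consistent. -/
lemma IsERM.consistent {X : Type u} {H : Set (X → Label)} {A : Set (X × Label) → X → Label}
    (hA : IsERM H A) {U : Set (X × Label)} {h : X → Label} (hh : h ∈ H)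
    (hU : ∀ p ∈ U, h p.1 = p.2) : ∀ p ∈ U, A U p.1 = p.2 := by
  have h0 : {p ∈ U | h p.1 ≠ p.2} = ∅ :=
    Set.eq_empty_of_forall_notMem fun p hp => hp.2 (hU p hp.1)
  have h1 := (hA U).2 h hh
  rw [h0, Set.encard_empty, nonpos_iff_eq_zero, Set.encard_eq_zero] at h1
  intro p hp
  by_contra hne
  exact Set.notMem_empty p (h1 ▸ ⟨hp, hne⟩)

/-- The sample size makes the deviation bound at most `δ`. -/
lemma deviation_bound_le {d m : ℕ} {ε δ : ℝ} (hε0 : 0 < ε) (hε : ε < 1 / 2) (hδ0 : 0 < δ)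
    (hδ : δ < 1 / 2)
    (hm : 100 * (d * Real.log (1 / ε) + Real.log (1 / δ)) ≤ ε * m) :
    2 * ((1 + ε / 32) ^ (2 * m) / ((ε / 32) ^ d * 2 ^ ⌈ε * m / 4⌉₊)) ≤ δ := by
  have hl2 : 0 < Real.log 2 := Real.log_pos (by norm_num)
  have hl2' : 0.6 < Real.log 2 := lt_trans (by norm_num) Real.log_two_gt_d9
  have hle : Real.log 2 ≤ Real.log (1 / ε) := by
    refine Real.log_le_log (by norm_num) ?_
    rw [le_div_iff₀ hε0]
    linarith
  have hld : Real.log 2 ≤ Real.log (1 / δ) := by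
    refine Real.log_le_log (by norm_num) ?_
    rw [le_div_iff₀ hδ0]
    linarith
  have hx : 0 < ε / 32 := by positivity
  have e1 : (1 + ε / 32) ^ (2 * m) ≤ Real.exp (ε * m / 16) := by
    calc (1 + ε / 32) ^ (2 * m) ≤ Real.exp (ε / 32) ^ (2 * m) := by
          refine pow_le_pow_left₀ (by positivity) ?_ _
          linarith [Real.add_one_le_exp (ε / 32)]
      _ = Real.exp (ε * m / 16) := by
          rw [← Real.exp_nat_mul]
          push_cast
          ring_nf
  have e2 : Real.exp (-(d * (6 * Real.log (1 / ε)))) ≤ (ε / 32) ^ d := by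
    -- `log 32 = 5 log 2`, and `log 2 ≤ log (1/ε)` since `ε < 1/2`.
    have : Real.log (1 / (ε / 32)) ≤ 6 * Real.log (1 / ε) := by
      have h32 : Real.log 32 = 5 * Real.log 2 := by
        rw [show (32 : ℝ) = 2 ^ 5 by norm_num, Real.log_pow]
        norm_num
      rw [show 1 / (ε / 32) = 32 * (1 / ε) by field_simp,
        Real.log_mul (by norm_num) (by positivity), h32]
      linarith
    calc Real.exp (-(d * (6 * Real.log (1 / ε))))
        ≤ Real.exp (d * Real.log (ε / 32)) := by
          refine Real.exp_le_exp.2 ?_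
          rw [one_div (ε / 32), Real.log_inv] at this
          rw [← mul_neg]
          exact mul_le_mul_of_nonneg_left (by linarith) (Nat.cast_nonneg d)
      _ = (ε / 32) ^ d := by rw [Real.exp_nat_mul, Real.exp_log hx]
  have e3 : Real.exp (Real.log 2 * (ε * m / 4)) ≤ 2 ^ ⌈ε * m / 4⌉₊ := by
    calc Real.exp (Real.log 2 * (ε * m / 4)) ≤ Real.exp (Real.log 2 * ⌈ε * m / 4⌉₊) :=
          Real.exp_le_exp.2 (mul_le_mul_of_nonneg_left (Nat.le_ceil _) hl2.le)
      _ = 2 ^ ⌈ε * m / 4⌉₊ := by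
          rw [Real.exp_mul, Real.exp_log (by norm_num), Real.rpow_natCast]
  have hdl : 0 ≤ d * Real.log (1 / ε) := mul_nonneg (Nat.cast_nonneg d) (hl2.le.trans hle)
  calc 2 * ((1 + ε / 32) ^ (2 * m) / ((ε / 32) ^ d * 2 ^ ⌈ε * m / 4⌉₊))
      ≤ Real.exp (Real.log 2) * (Real.exp (ε * m / 16) /
          (Real.exp (-(d * (6 * Real.log (1 / ε)))) * Real.exp (Real.log 2 * (ε * m / 4)))) := by
        rw [Real.exp_log (by norm_num)]
        gcongr
    _ = Real.exp (Real.log 2 + (ε * m / 16 -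
          (-(d * (6 * Real.log (1 / ε))) + Real.log 2 * (ε * m / 4)))) := by
        rw [Real.exp_add, Real.exp_sub, Real.exp_add]
    _ ≤ Real.exp (-Real.log (1 / δ)) := by
        refine Real.exp_le_exp.2 ?_
        have : 0.6 * (ε * m / 4) ≤ Real.log 2 * (ε * m / 4) :=
          mul_le_mul_of_nonneg_right hl2'.le (by positivity)
        -- The net gain is `(0.15 - 1/16) εm = 0.0875 εm`, at least `8.75 (d log (1/ε) + log
        -- (1/δ))`. It pays for `6 d log (1/ε) + log (1/δ) + log 2`, as `log 2 ≤ log (1/δ)`.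
        linarith
    _ = δ := by
        rw [one_div, Real.log_inv, neg_neg, Real.exp_log hδ0]

end TransformShift

open TransformShift in
theorem mainTheorem10 :
    ∃ C : ℝ, 0 < C ∧
      ∀ (X : Type u) [MeasurableSpace X]
        (H : Set (X → TransformShift.Label)) (𝒯 : Set (X → X))
        (A : Set (X × TransformShift.Label) → X → TransformShift.Label)
        (D : Measure (X × TransformShift.Label)) [IsProbabilityMeasure D],
        (∀ h ∈ H, Measurable h) → (∀ T ∈ 𝒯, Measurable T) →
        TransformShift.WellBehaved D (TransformShift.compClass H 𝒯) →
        TransformShift.IsERM H A →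
        TransformShift.optInf D H 𝒯 = 0 →
        (𝒯.Infinite → TransformShift.RealizableAE D H 𝒯) →
        ∀ d : ℕ, TransformShift.vcDim (TransformShift.compClass H 𝒯) = (d : ℕ∞) →
        ∀ ε δ : ℝ, 0 < ε → ε < 1 / 2 → 0 < δ → δ < 1 / 2 →
        ∀ m : ℕ, C * ((d * Real.log (1 / ε) + Real.log (1 / δ)) / ε) ≤ m →
          (Measure.pi fun _ : Fin m => D)
            {S | ¬ ∀ T ∈ 𝒯, TransformShift.err D (A (TransformShift.inflate 𝒯 S)) T ≤ ε}
          ≤ ENNReal.ofReal δ := by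
  refine ⟨100, by norm_num, ?_⟩
  intro X _ H 𝒯 A D _ hH h𝒯 hW hA hopt hinf d hd ε δ hε0 hε hδ0 hδ m hm
  have hm' : 100 * (d * Real.log (1 / ε) + Real.log (1 / δ)) ≤ ε * m := by
    rw [← mul_div_assoc, div_le_iff₀ hε0] at hm
    linarith
  -- The `δ` term alone suffices, even for `d = 0`: `100 log (1/δ) ≥ 100 log 2 > 60`.
  have hεm : 4 ≤ ε * m := by
    have hl2 : 0.6 < Real.log 2 := lt_trans (by norm_num) Real.log_two_gt_d9
    have hld : Real.log 2 ≤ Real.log (1 / δ) := by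
      refine Real.log_le_log (by norm_num) ?_
      rw [le_div_iff₀ hδ0]
      linarith
    have hle : 0 ≤ Real.log (1 / ε) := by
      refine Real.log_nonneg ?_
      rw [le_div_iff₀ hε0]
      linarith
    have hdl : 0 ≤ d * Real.log (1 / ε) := mul_nonneg (Nat.cast_nonneg d) hle
    linarith
  have hF : ∀ f ∈ compClass H 𝒯, Measurable f := by
    rintro _ ⟨h, hh, T, hT, rfl⟩
    exact (hH h hh).comp (h𝒯 T hT)
  -- No measurability of the ERM is available; covering the failure event suffices, since outer
  -- measure is monotone and subadditive.
  have hcov : {S : Fin m → X × Label | ¬ ∀ T ∈ 𝒯, err D (A (inflate 𝒯 S)) T ≤ ε} ⊆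
      {S | ¬ ∃ h ∈ H, ∀ i, ∀ T ∈ 𝒯, h (T (S i).1) = (S i).2} ∪
      {S | ∃ f ∈ compClass H 𝒯, (∀ i, f (S i).1 = (S i).2) ∧
        ε < D.real {p | f p.1 ≠ p.2}} := by
    intro S hS
    by_cases hcons : ∃ h ∈ H, ∀ i, ∀ T ∈ 𝒯, h (T (S i).1) = (S i).2
    · right
      obtain ⟨h, hh, hc⟩ := hcons
      have hAc := hA.consistent (U := inflate 𝒯 S) hh (by
        rintro _ ⟨i, T, hT, rfl⟩
        exact hc i T hT)
      simp only [Set.mem_ofPred_eq, not_forall, not_le] at hS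
      obtain ⟨T, hT, herr⟩ := hS
      exact ⟨_, ⟨_, (hA _).1, T, hT, rfl⟩, fun i => hAc _ ⟨i, T, hT, rfl⟩, herr⟩
    · exact Or.inl hcons
  calc _ ≤ _ := measure_mono hcov
    _ ≤ _ := measure_union_le _ _
    _ ≤ 0 + ENNReal.ofReal
          (2 * ((1 + ε / 32) ^ (2 * m) / ((ε / 32) ^ d * 2 ^ ⌈ε * m / 4⌉₊))) :=
        add_le_add
          -- The output on the empty dataset witnesses that `H` is nonempty.
          (measure_not_consistent_eq_zero ⟨_, (hA ∅).1⟩ hopt hinf m).le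
          (measure_exists_consistent_le D hF hW hd hεm (by positivity) (by linarith))
    _ ≤ ENNReal.ofReal δ := by
        rw [zero_add]
        exact ENNReal.ofReal_le_ofReal (deviation_bound_le hε0 hε hδ0 hδ hm')
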